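/- Let $n\ge 0$ be an integer and let $F$ be a complex Banach space (for instance $F=\mathbb{C}$ for scalar functions, $F=\mathbb{C}^m$ for vector or tensor fields). Let $\varphi:\mathbb{R}^n\to[0,1]$ be smooth and radial, supported in the annulus $\{3/4\le|\xi|\le 8/3\}$, with $\sum_{j\in\mathbb{Z}}\varphi(2^{-j}\xi)=1$ for all $\xi\neq 0$. For an $F$-valued tempered distribution $f$ on $\mathbb{R}^n$ let $\Delta_jf$ ($j\in\mathbb{Z}$) and $e^{t\Delta}f$ ($t\ge 0$) be the distributions whose Fourier transforms are $\varphi(2^{-j}\xi)\widehat f(\xi)$ and $e^{-t|\xi|^2}\widehat f(\xi)$, where $\widehat f(\xi)=\int e^{-ix\cdot\xi}f(x)\,dx$ for integrable $f$; and let $\|f\|_r\in[0,\infty]$ be the $L^r(\mathbb{R}^n;F)$ norm of $f$, equal to $\infty$ if $f\notin L^r$. Let $\mathcal{S}'_h$ be the space of tempered distributions $f$ such that, for every $\theta\in C_c^\infty(\mathbb{R}^n;\mathbb{C})$, the distribution with Fourier transform $\theta(\lambda\xi)\widehat f(\xi)$ tends to $0$ in $L^\infty$ norm as $\lambda\to+\infty$.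 For $\sigma\in\mathbb{R}$ and $1\le r\le\infty$ set $$\dot B^{\sigma}_{r,\infty}=\Bigl\{f\in\mathcal{S}'_h:\ \sup_{j\in\mathbb{Z}}2^{j\sigma}\|\Delta_jf\|_r<\infty\Bigr\},\qquad \dot B^{\sigma}_{r,c_0}=\Bigl\{f\in\dot B^{\sigma}_{r,\infty}:\ \lim_{j\to-\infty}2^{j\sigma}\|\Delta_jf\|_r=0\Bigr\}.$$ Let $1\le r\le\infty$, $s>0$ and $f\in\dot B^{-s}_{r,\infty}$. Then $f\in\dot B^{-s}_{r,c_0}$ if and only if $$\lim_{t\to+\infty}t^{s/2}\,\|e^{t\Delta}f\|_r=0 .$$ -/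

import Mathlib

open MeasureTheory Filter Topology TemperedDistribution
open scoped SchwartzMap ENNReal ContDiff

noncomputable section

namespace HeatBesov

/-- A dyadic partition of unity on `ℝⁿ` minus the origin: a smooth radial function `φ` with values
in `[0, 1]`, supported in the annulus `3/4 ≤ |ξ| ≤ 8/3`, with `∑_{j ∈ ℤ} φ (2^{-j} ξ) = 1` for all
`ξ ≠ 0`. -/
structure DyadicPartition (n : ℕ) where
  toFun : EuclideanSpace ℝ (Fin n) → ℝ
  contDiff : ContDiff ℝ ∞ toFun
  radial : ∀ ξ η, ‖ξ‖ = ‖η‖ → toFun ξ = toFun η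
  mem_Icc : ∀ ξ, toFun ξ ∈ Set.Icc (0 : ℝ) 1
  tsupport_subset : tsupport toFun ⊆ {ξ | 3 / 4 ≤ ‖ξ‖ ∧ ‖ξ‖ ≤ 8 / 3}
  hasSum : ∀ ξ, ξ ≠ 0 → HasSum (fun j : ℤ => toFun ((2 : ℝ) ^ (-j) • ξ)) 1

/-- Dyadic partitions of unity exist. -/
theorem DyadicPartition.nonempty (n : ℕ) : Nonempty (DyadicPartition n) := by
  obtain ⟨c, hc, hm, h0, h1, c0, c1⟩ : ∃ c : ℝ → ℝ, ContDiff ℝ ∞ c ∧ Antitone c ∧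
      (∀ x, 0 ≤ c x) ∧ (∀ x, c x ≤ 1) ∧ (∀ x, 9 / 7 ≤ x → c x = 0) ∧
      (∀ x, x ≤ 9 / 16 → c x = 1) :=
    ⟨fun x => Real.smoothTransition (16 / 7 - 16 / 9 * x),
      Real.smoothTransition.contDiff.comp (by fun_prop),
      fun a b h => Real.smoothTransition.monotone (by linarith),
      fun x => Real.smoothTransition.nonneg _, fun x => Real.smoothTransition.le_one _,
      fun x h => Real.smoothTransition.zero_of_nonpos (by linarith),
      fun x h => Real.smoothTransition.one_of_one_le (by linarith)⟩
  refine ⟨⟨fun ξ => c (‖ξ‖ ^ 2 / 4) - c (‖ξ‖ ^ 2), ?_, ?_, ?_, ?_, ?_⟩⟩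
  · have h2 : ContDiff ℝ ∞ (fun ξ : EuclideanSpace ℝ (Fin n) => ‖ξ‖ ^ 2) := contDiff_norm_sq ℝ
    exact (hc.comp (h2.div_const 4)).sub (hc.comp h2)
  · intro ξ η h
    simp only [h]
  · intro ξ
    have h2 := hm (show ‖ξ‖ ^ 2 / 4 ≤ ‖ξ‖ ^ 2 by nlinarith [sq_nonneg ‖ξ‖])
    constructor <;> linarith [h0 (‖ξ‖ ^ 2), h1 (‖ξ‖ ^ 2 / 4)]
  · refine closure_minimal (fun ξ h => ?_)
      ((isClosed_le continuous_const continuous_norm).inter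
        (isClosed_le continuous_norm continuous_const))
    have hn := norm_nonneg ξ
    constructor <;> by_contra hh <;> refine h ?_ <;> rw [not_le] at hh
    · simp only
      rw [c1 _ (by nlinarith), c1 _ (by nlinarith), sub_self]
    · simp only
      rw [c0 _ (by nlinarith), c0 _ (by nlinarith), sub_self]
  · intro ξ hξ
    obtain ⟨m, hm1, hm2⟩ := exists_mem_Ico_zpow (norm_pos_iff.2 hξ) (one_lt_two (α := ℝ))
    set g : ℤ → ℝ := fun j => c (((2 : ℝ) ^ (-j) * ‖ξ‖) ^ 2) with hg
    have e : (fun j : ℤ => c (‖(2 : ℝ) ^ (-j) • ξ‖ ^ 2 / 4) - c (‖(2 : ℝ) ^ (-j) • ξ‖ ^ 2)) =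
        fun j => g (j + 1) - g j := by
      funext j
      simp only [hg, norm_smul, norm_zpow, Real.norm_ofNat]
      congr 2
      rw [neg_add, zpow_add₀ two_ne_zero]
      norm_num
      ring
    have g0 : ∀ j, j ≤ m - 1 → g j = 0 := fun j hj => by
      have h1 : (2 : ℝ) ^ (1 : ℤ) ≤ 2 ^ (-j + m) := zpow_le_zpow_right₀ one_le_two (by omega)
      rw [zpow_add₀ two_ne_zero, zpow_one] at h1
      have h2 := mul_le_mul_of_nonneg_left hm1 (by positivity : (0 : ℝ) ≤ 2 ^ (-j))
      exact c0 _ (by nlinarith)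
    have g1 : ∀ j, m + 2 ≤ j → g j = 1 := fun j hj => by
      have h1 : (2 : ℝ) ^ (-j + (m + 1)) ≤ 2 ^ (-1 : ℤ) :=
        zpow_le_zpow_right₀ one_le_two (by omega)
      rw [zpow_add₀ two_ne_zero, zpow_neg_one] at h1
      have h2 := mul_le_mul_of_nonneg_left hm2.le (by positivity : (0 : ℝ) ≤ 2 ^ (-j))
      have h3 : 0 ≤ (2 : ℝ) ^ (-j) * ‖ξ‖ := by positivity
      exact c1 _ (by nlinarith)
    rw [e]
    have hs : HasSum (fun j => g (j + 1) - g j)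
        (∑ j ∈ ({m - 1, m, m + 1} : Finset ℤ), (g (j + 1) - g j)) := by
      refine hasSum_sum_of_ne_finset_zero fun j hj => ?_
      simp only [Finset.mem_insert, Finset.mem_singleton, not_or] at hj
      rcases (by omega : j + 1 ≤ m - 1 ∨ m + 2 ≤ j) with h | h
      · rw [g0 _ h, g0 _ (by omega), sub_self]
      · rw [g1 _ h, g1 _ (by omega), sub_self]
    convert hs using 1
    rw [Finset.sum_insert (by simp; omega), Finset.sum_insert (by simp), Finset.sum_singleton,
      sub_add_cancel, g0 (m - 1) le_rfl, add_assoc m 1 1, one_add_one_eq_two, g1 (m + 2) le_rfl]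
    ring

variable {n : ℕ} {F : Type*} [NormedAddCommGroup F] [NormedSpace ℂ F]

/-- The operator `m(D)`, `D = -i∇`, on tempered distributions. Mathlib's Fourier transform has the
kernel `exp (-2πi x·ξ)`, so that `D` has the symbol `2πξ`. -/
def multiplier (m : EuclideanSpace ℝ (Fin n) → ℂ) :
    𝓢'(EuclideanSpace ℝ (Fin n), F) →L[ℂ] 𝓢'(EuclideanSpace ℝ (Fin n), F) :=
  fourierMultiplierCLM F (fun ξ => m ((2 * Real.pi) • ξ))

/-- The homogeneous dyadic block `Δ_j = φ(2^{-j} D)`. -/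
def dyadicBlock (φ : DyadicPartition n) (j : ℤ) :
    𝓢'(EuclideanSpace ℝ (Fin n), F) →L[ℂ] 𝓢'(EuclideanSpace ℝ (Fin n), F) :=
  multiplier (fun ξ => (φ.toFun ((2 : ℝ) ^ (-j) • ξ) : ℂ))

/-- The heat operator `e^{tΔ}`, with symbol `exp (-t |ξ|²)`; it is used for `t ≥ 0`. -/
def heat (t : ℝ) :
    𝓢'(EuclideanSpace ℝ (Fin n), F) →L[ℂ] 𝓢'(EuclideanSpace ℝ (Fin n), F) :=
  multiplier (fun ξ => (Real.exp (-t * ‖ξ‖ ^ 2) : ℂ))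

variable [CompleteSpace F]

/-- The `L^r` norm of a tempered distribution: the `L^r` norm of the (unique) function
representing it, and `∞` if no function in `L^r` represents it. -/
def lrNorm (r : ℝ≥0∞) [Fact (1 ≤ r)] (u : 𝓢'(EuclideanSpace ℝ (Fin n), F)) : ℝ≥0∞ :=
  ⨅ (g : Lp F r (volume : Measure (EuclideanSpace ℝ (Fin n))))
    (_ : Lp.toTemperedDistribution g = u), ‖g‖ₑ

theorem lrNorm_toTemperedDistribution (r : ℝ≥0∞) [Fact (1 ≤ r)]
    (g : Lp F r (volume : Measure (EuclideanSpace ℝ (Fin n)))) :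
    lrNorm r (Lp.toTemperedDistribution g) = ‖g‖ₑ := by
  refine le_antisymm (iInf_le_of_le g (iInf_le_of_le rfl le_rfl))
    (le_iInf₂ fun h hh => ?_)
  have hinj := LinearMap.ker_eq_bot.1 (Lp.ker_toTemperedDistributionCLM_eq_bot (F := F)
    (μ := (volume : Measure (EuclideanSpace ℝ (Fin n)))) (p := r))
  rw [hinj hh]

/-- The space `𝓢'_h` of tempered distributions `u` with `‖θ(λD) u‖_∞ → 0` as `λ → ∞` for every
test function `θ`. -/
def homogeneousDistributions (n : ℕ) (F : Type*) [NormedAddCommGroup F] [NormedSpace ℂ F]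
    [CompleteSpace F] : Set 𝓢'(EuclideanSpace ℝ (Fin n), F) :=
  {u | ∀ θ : EuclideanSpace ℝ (Fin n) → ℂ, ContDiff ℝ ∞ θ → HasCompactSupport θ →
    Tendsto (fun l : ℝ => lrNorm (⊤ : ℝ≥0∞) (multiplier (fun ξ => θ (l • ξ)) u)) atTop (𝓝 0)}

/-- `2^{jσ} ‖Δ_j u‖_r`. -/
def besovTerm (φ : DyadicPartition n) (σ : ℝ) (r : ℝ≥0∞) [Fact (1 ≤ r)]
    (u : 𝓢'(EuclideanSpace ℝ (Fin n), F)) (j : ℤ) : ℝ≥0∞ :=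
  ENNReal.ofReal ((2 : ℝ) ^ ((j : ℝ) * σ)) * lrNorm r (dyadicBlock φ j u)

/-- The homogeneous Besov space `Ḃ^σ_{r,∞}(ℝⁿ)`, with norm `sup_j 2^{jσ} ‖Δ_j u‖_r`. -/
def besov (φ : DyadicPartition n) (F : Type*) [NormedAddCommGroup F] [NormedSpace ℂ F]
    [CompleteSpace F] (σ : ℝ) (r : ℝ≥0∞) [Fact (1 ≤ r)] :
    Set 𝓢'(EuclideanSpace ℝ (Fin n), F) :=
  {u | u ∈ homogeneousDistributions n F ∧ (⨆ j : ℤ, besovTerm φ σ r u j) < (⊤ : ℝ≥0∞)}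

/-- The subspace `Ḃ^σ_{r,c₀}(ℝⁿ)` of `Ḃ^σ_{r,∞}(ℝⁿ)`: `2^{jσ} ‖Δ_j u‖_r → 0` as `j → -∞`. -/
def besovC0 (φ : DyadicPartition n) (F : Type*) [NormedAddCommGroup F] [NormedSpace ℂ F]
    [CompleteSpace F] (σ : ℝ) (r : ℝ≥0∞) [Fact (1 ≤ r)] :
    Set 𝓢'(EuclideanSpace ℝ (Fin n), F) :=
  {u | u ∈ besov φ F σ r ∧ Tendsto (besovTerm φ σ r u) atBot (𝓝 0)}

end HeatBesov

end

/-!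
The proof compares the heat flow at time `t` with the dyadic blocks at frequencies near `t^{-1/2}`.

All `L^r` bounds come from one fact, `exists_lrNorm_multiplier_le`: a multiplier `m (c D)` with `m`
a Schwartz function is bounded on `L^r`, uniformly in `c > 0`. It is the convolution with
`𝓕⁻ (m (c ·))`, whose `L¹` norm does not depend on `c`, so Young's inequality `L¹ * L^r ⊆ L^r`
applies, in the form of `eLpNorm_lintegral_sub_mul_le`.

If the heat norms decay, write `φ (2^{-j} ξ) = ψ (2^{-j} ξ) exp (-4^{-j} |ξ|²)` with
`ψ (ξ) = φ (ξ) exp (|ξ|²)`, which is smooth and compactly supported. Hence `‖Δ_j f‖_r` is at most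
`C ‖e^{tΔ} f‖_r` with `t = 4^{-j}`, and `t → ∞` as `j → -∞`.

Conversely, `e^{tΔ} Δ_j f` is `(t 4^j)^{-N}` times the image of `Δ_j f` under the multipliers with
symbols `|√t ξ|^{2N} exp (-|√t ξ|²)` and `|2^{-j} ξ|^{-2N}`, where the second symbol is modified off
the support of `φ (2^{-j} ·)` so as to be smooth and compactly supported. Thus
`‖e^{tΔ} Δ_j f‖_r ≤ C min (1, (t 4^j)^{-N}) ‖Δ_j f‖_r`. With `N ≥ s`, the quantity
`t^{s/2} ‖e^{tΔ} f‖_r` is bounded by `∑_j w (j + ⌊log₄ t⌋) 2^{-js} ‖Δ_j f‖_r` with a summable weight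
`w`, and after a shift of `j` dominated convergence gives the limit `0`.

The decomposition `f = ∑_j Δ_j f` used here (`tendsto_sum_dyadicBlock`) telescopes: the partial sums
are differences of two low frequency cutoffs. One tends to `f`, since truncations of a Schwartz
function converge to it in the Schwartz space; the other tends to `0` because `f ∈ 𝓢'_h`.
-/

namespace HeatBesov

/-! ### Young's inequality for absolute values -/

section Young

variable {G F : Type*} [AddCommGroup G] [MeasurableSpace G] [MeasurableAdd₂ G] [MeasurableNeg G]
  {μ : Measure G} [SFinite μ] [μ.IsAddLeftInvariant] [μ.IsNegInvariant] [NormedAddCommGroup F]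

/-- Young's inequality `L¹ * L^p ⊆ L^p` for `p < ∞`, by Jensen's inequality and Tonelli's
theorem. -/
theorem lintegral_rpow_lintegral_sub_mul_le {k : G → ℝ≥0∞} (hk : Measurable k) {p : ℝ}
    (hp : 1 ≤ p) {g : G → F} (hg : StronglyMeasurable g) :
    ∫⁻ x, (∫⁻ y, k (x - y) * ‖g y‖ₑ ∂μ) ^ p ∂μ ≤ (∫⁻ y, k y ∂μ) ^ p * ∫⁻ y, ‖g y‖ₑ ^ p ∂μ := by
  have hp0 : 0 < p := by linarith
  have hsub : Measurable fun q : G × G => q.1 - q.2 := by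
    simp only [sub_eq_add_neg]
    exact measurable_fst.add measurable_snd.neg
  have hgm : Measurable fun y => ‖g y‖ₑ := hg.enorm
  have hkx : ∀ x, Measurable fun y => k (x - y) := fun x =>
    (hk.comp hsub).comp measurable_prodMk_left
  have hjoint : Measurable fun q : G × G => k (q.1 - q.2) * ‖g q.2‖ₑ ^ p :=
    (hk.comp hsub).mul ((hgm.pow_const _).comp measurable_snd)
  -- Jensen's inequality for the measure with density `k (x - ·)`
  have key : ∀ x, (∫⁻ y, k (x - y) * ‖g y‖ₑ ∂μ) ^ p ≤
      (∫⁻ y, k y ∂μ) ^ (p - 1) * ∫⁻ y, k (x - y) * ‖g y‖ₑ ^ p ∂μ := by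
    intro x
    have h := eLpNorm_le_eLpNorm_mul_rpow_measure_univ (f := g) (p := 1) (q := ENNReal.ofReal p)
      (μ := μ.withDensity fun y => k (x - y)) (by simpa using hp) hg.aestronglyMeasurable
    rw [eLpNorm_one_eq_lintegral_enorm,
      eLpNorm_eq_lintegral_rpow_enorm_toReal (by simpa using hp0) ENNReal.ofReal_ne_top,
      lintegral_withDensity_eq_lintegral_mul _ (hkx x) hgm,
      lintegral_withDensity_eq_lintegral_mul _ (hkx x) (hgm.pow_const _),
      withDensity_apply _ MeasurableSet.univ, setLIntegral_univ, lintegral_sub_left_eq_self,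
      ENNReal.toReal_ofReal hp0.le, ENNReal.toReal_one] at h
    refine (ENNReal.rpow_le_rpow h hp0.le).trans_eq ?_
    rw [ENNReal.mul_rpow_of_nonneg _ _ hp0.le, ← ENNReal.rpow_mul, ← ENNReal.rpow_mul, mul_comm,
      one_div_mul_cancel hp0.ne', ENNReal.rpow_one]
    congr 2
    field_simp
  refine (lintegral_mono key).trans_eq ?_
  rw [lintegral_const_mul _ hjoint.lintegral_prod_right',
    lintegral_lintegral_swap hjoint.aemeasurable]
  have hin : ∀ y, ∫⁻ x, k (x - y) * ‖g y‖ₑ ^ p ∂μ = (∫⁻ x, k x ∂μ) * ‖g y‖ₑ ^ p := fun y => by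
    have hky : Measurable fun x => k (x - y) := (hk.comp hsub).comp measurable_prodMk_right
    rw [lintegral_mul_const _ hky, lintegral_sub_right_eq_self]
  simp only [hin]
  rw [lintegral_const_mul _ (hgm.pow_const _), ← mul_assoc]
  congr 1
  nth_rewrite 2 [← ENNReal.rpow_one (∫⁻ y, k y ∂μ)]
  rw [← ENNReal.rpow_add_of_nonneg _ _ (by linarith) zero_le_one, sub_add_cancel]

/-- Young's inequality `L¹ * L^r ⊆ L^r` for the convolution of absolute values. -/
theorem eLpNorm_lintegral_sub_mul_le {k : G → ℝ≥0∞} (hk : Measurable k) {r : ℝ≥0∞}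
    (hr : 1 ≤ r) {g : G → F} (hg : StronglyMeasurable g) :
    eLpNorm (fun x => ∫⁻ y, k (x - y) * ‖g y‖ₑ ∂μ) r μ ≤ (∫⁻ y, k y ∂μ) * eLpNorm g r μ := by
  have hkx : ∀ x, Measurable fun y => k (x - y) := fun x => by
    simp only [sub_eq_add_neg]
    exact hk.comp (measurable_const.add measurable_neg)
  rcases eq_or_ne r ∞ with rfl | hrt
  · rw [eLpNorm_exponent_top, eLpNorm_exponent_top]
    refine essSup_le_of_ae_le _ (Eventually.of_forall fun x => ?_)
    simp only [enorm_eq_self]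
    calc ∫⁻ y, k (x - y) * ‖g y‖ₑ ∂μ
        ≤ ∫⁻ y, k (x - y) * eLpNormEssSup g μ ∂μ := by
          refine lintegral_mono_ae ?_
          filter_upwards [enorm_ae_le_eLpNormEssSup g μ] with y hy
          gcongr
      _ = _ := by rw [lintegral_mul_const _ (hkx x), lintegral_sub_left_eq_self]
  have hr0 : r ≠ 0 := (zero_lt_one.trans_le hr).ne'
  have hp : 1 ≤ r.toReal := by
    rw [← ENNReal.toReal_one]; exact (ENNReal.toReal_le_toReal ENNReal.one_ne_top hrt).2 hr
  have hp0 : 0 < r.toReal := by linarith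
  rw [eLpNorm_eq_lintegral_rpow_enorm_toReal hr0 hrt,
    eLpNorm_eq_lintegral_rpow_enorm_toReal hr0 hrt]
  simp only [enorm_eq_self]
  refine (ENNReal.rpow_le_rpow (lintegral_rpow_lintegral_sub_mul_le hk hp hg)
    (by positivity : 0 ≤ 1 / r.toReal)).trans_eq ?_
  rw [ENNReal.mul_rpow_of_nonneg _ _ (by positivity), ← ENNReal.rpow_mul,
    mul_one_div_cancel hp0.ne', ENNReal.rpow_one]

end Young

theorem ae_lt_top_of_eLpNorm_lt_top {α : Type*} [MeasurableSpace α] {μ : Measure α}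
    {H : α → ℝ≥0∞} (hH : Measurable H) {r : ℝ≥0∞} (hr0 : r ≠ 0) (hr : eLpNorm H r μ < ⊤) :
    ∀ᵐ x ∂μ, H x < ⊤ := by
  rcases eq_or_ne r ⊤ with rfl | hrt
  · rw [eLpNorm_exponent_top] at hr
    filter_upwards [enorm_ae_le_eLpNormEssSup H μ] with x hx
    exact (by simpa using hx : H x ≤ _).trans_lt hr
  · have hp := ENNReal.toReal_pos hr0 hrt
    have h := lintegral_rpow_enorm_lt_top_of_eLpNorm_lt_top hr0 hrt hr
    filter_upwards [ae_lt_top (hH.pow_const r.toReal) (by simpa using h.ne)] with x hx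
    exact (ENNReal.rpow_lt_top_iff_of_pos hp).1 hx

/-! ### Fourier multipliers with Schwartz symbols on `L^r` -/

section Multiplier

open FourierTransform

variable {n : ℕ} {F : Type*} [NormedAddCommGroup F] [NormedSpace ℂ F]

local notation "𝔼" => EuclideanSpace ℝ (Fin n)

/-- The transpose of the multiplier `m` acts on test functions as the convolution with the
reflected kernel. -/
theorem fourier_smulLeft_fourierInv_apply (m u : 𝓢(𝔼, ℂ)) (y : 𝔼) :
    𝓕 (SchwartzMap.smulLeftCLM ℂ m (𝓕⁻ u)) y = ∫ x, u x * 𝓕⁻ m (x - y) := by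
  have h : 𝓕 (SchwartzMap.smulLeftCLM ℂ m (𝓕⁻ u)) =
      SchwartzMap.convolution (ContinuousLinearMap.mul ℂ ℂ) (𝓕 m) u := by
    have h2 : 𝓕⁻ (SchwartzMap.convolution (ContinuousLinearMap.mul ℂ ℂ) (𝓕 m) u) =
        SchwartzMap.smulLeftCLM ℂ m (𝓕⁻ u) := by
      have h3 : ∀ (v : 𝓢(𝔼, ℂ)) (ξ : 𝔼), 𝓕⁻ v ξ = 𝓕 v (-ξ) := fun v ξ => by
        rw [SchwartzMap.fourierInv_apply_eq]; rfl
      ext ξ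
      rw [h3, SchwartzMap.fourier_convolution, SchwartzMap.pairing_apply_apply, ← h3, ← h3,
        FourierTransform.fourierInv_fourier_eq,
        SchwartzMap.smulLeftCLM_apply_apply m.hasTemperateGrowth]
      rfl
    rw [← h2, FourierTransform.fourier_fourierInv_eq]
  rw [h, SchwartzMap.convolution_apply, ← convolution_flip]
  simp only [convolution]
  refine integral_congr_ae (Eventually.of_forall fun x => ?_)
  simp only [ContinuousLinearMap.flip_apply, ContinuousLinearMap.mul_apply']
  have h4 : 𝓕⁻ m (x - y) = 𝓕 m (-(x - y)) := by
    rw [SchwartzMap.fourierInv_apply_eq]; rfl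
  rw [mul_comm, h4, neg_sub]

variable [CompleteSpace F]

/-- A Fourier multiplier with a Schwartz symbol `m` acts on `L^r` by convolution with `𝓕⁻ m`. -/
theorem exists_Lp_fourierMultiplier {r : ℝ≥0∞} [hr : Fact (1 ≤ r)] (m : 𝓢(𝔼, ℂ))
    (g : Lp F r (volume : Measure 𝔼)) :
    ∃ h : Lp F r (volume : Measure 𝔼),
      Lp.toTemperedDistribution h = fourierMultiplierCLM F m (Lp.toTemperedDistribution g) ∧
      ‖h‖ₑ ≤ (∫⁻ x, ‖𝓕⁻ m x‖ₑ) * ‖g‖ₑ := by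
  set K : 𝓢(𝔼, ℂ) := 𝓕⁻ m with hK
  have hKc : Continuous K := K.continuous
  have hg : StronglyMeasurable g := Lp.stronglyMeasurable g
  have hKm : Measurable fun x => ‖K x‖ₑ := Continuous.measurable (by fun_prop)
  have hjoint : StronglyMeasurable fun p : 𝔼 × 𝔼 => K (p.1 - p.2) • g p.2 :=
    (Continuous.stronglyMeasurable (by fun_prop)).smul (hg.comp_measurable measurable_snd)
  set h : 𝔼 → F := fun x => ∫ y, K (x - y) • g y with hh
  have hm : StronglyMeasurable h := hjoint.integral_prod_right'
  set H : 𝔼 → ℝ≥0∞ := fun x => ∫⁻ y, ‖K (x - y)‖ₑ * ‖g y‖ₑ with hH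
  have hHm : Measurable H := by
    have := hjoint.enorm.lintegral_prod_right' (ν := (volume : Measure 𝔼))
    simpa only [enorm_smul] using this
  have hHr : eLpNorm H r volume ≤ (∫⁻ x, ‖K x‖ₑ) * eLpNorm g r volume :=
    eLpNorm_lintegral_sub_mul_le hKm hr.out hg
  have hKfin : ∫⁻ x, ‖K x‖ₑ < ⊤ := K.integrable.hasFiniteIntegral
  have hHfin : eLpNorm H r volume < ⊤ :=
    hHr.trans_lt (ENNReal.mul_lt_top hKfin (Lp.eLpNorm_lt_top g))
  have hhr : eLpNorm h r volume ≤ (∫⁻ x, ‖K x‖ₑ) * eLpNorm g r volume := by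
    refine le_trans (eLpNorm_mono_enorm fun x => ?_) hHr
    simp only [hh, hH, enorm_eq_self, ← enorm_smul]
    exact enorm_integral_le_lintegral_enorm _
  have hLp : MemLp h r volume := ⟨hm.aestronglyMeasurable,
    hhr.trans_lt (ENNReal.mul_lt_top hKfin (Lp.eLpNorm_lt_top g))⟩
  refine ⟨hLp.toLp h, ?_, ?_⟩
  swap
  · rw [Lp.enorm_toLp, Lp.enorm_def]; exact hhr
  ext u
  rw [fourierMultiplierCLM_apply_apply, Lp.toTemperedDistribution_apply,
    Lp.toTemperedDistribution_apply]
  -- Fubini applies by Hölder's inequality, since `H ∈ L^r` and `u` is in the dual exponent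
  have hint : Integrable (Function.uncurry fun x y : 𝔼 => u x • K (x - y) • g y)
      (volume.prod volume) := by
    have huc := u.continuous
    have hsm : StronglyMeasurable (Function.uncurry fun x y : 𝔼 => u x • K (x - y) • g y) :=
      (Continuous.stronglyMeasurable (f := fun p : 𝔼 × 𝔼 => u p.1) (by fun_prop)).smul hjoint
    refine ⟨hsm.aestronglyMeasurable, ?_⟩
    rw [hasFiniteIntegral_iff_enorm, lintegral_prod _ hsm.enorm.aemeasurable]
    have e : ∀ x, ∫⁻ y, ‖Function.uncurry (fun x y : 𝔼 => u x • K (x - y) • g y) (x, y)‖ₑ =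
        ‖u x‖ₑ * H x := fun x => by
      simp only [Function.uncurry_apply_pair, enorm_smul, hH]
      rw [lintegral_const_mul]
      exact (Continuous.measurable (f := fun y : 𝔼 => ‖K (x - y)‖ₑ) (by fun_prop)).mul hg.enorm
    simp only [e]
    have := ENNReal.HolderConjugate.inv_one_sub_inv' hr.out
    have hH0 : MemLp (fun x => (H x).toReal) r volume := by
      refine ⟨hHm.ennreal_toReal.aestronglyMeasurable, lt_of_le_of_lt ?_ hHfin⟩
      exact eLpNorm_mono_enorm fun x => by
        rw [enorm_eq_self, Real.enorm_of_nonneg ENNReal.toReal_nonneg]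
        exact ENNReal.ofReal_toReal_le
    have hprod : MemLp (fun x => u x * ((H x).toReal : ℂ)) 1 volume :=
      MemLp.mul' (p := (1 - r⁻¹)⁻¹) (q := r) hH0.ofReal (u.memLp _ volume)
    refine lt_of_le_of_lt (lintegral_mono_ae ?_) (memLp_one_iff_integrable.1 hprod).2
    have hr0 : r ≠ 0 := (zero_lt_one.trans_le hr.out).ne'
    filter_upwards [ae_lt_top_of_eLpNorm_lt_top hHm hr0 hHfin] with x hx
    rw [enorm_mul, ← ofReal_norm (((H x).toReal : ℂ)), Complex.norm_of_nonneg ENNReal.toReal_nonneg,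
      ENNReal.ofReal_toReal hx.ne]
  calc ∫ x, u x • (hLp.toLp h) x = ∫ x, u x • h x := by
        refine integral_congr_ae ?_
        filter_upwards [hLp.coeFn_toLp] with x hx
        rw [hx]
    _ = ∫ x, ∫ y, u x • K (x - y) • g y := by
        simp only [hh, integral_smul]
    _ = ∫ y, ∫ x, u x • K (x - y) • g y := integral_integral_swap hint
    _ = _ := by
        refine integral_congr_ae (Eventually.of_forall fun y => ?_)
        simp only [fourier_smulLeft_fourierInv_apply, smul_smul]
        rw [integral_smul_const]

/-- The `L¹` norm of `𝓕⁻ m` is invariant under dilations of `m`. -/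
theorem enorm_fourierInv_comp_smul (m m' : 𝓢(𝔼, ℂ)) {c : ℝ} (hc : c ≠ 0)
    (h : ∀ ξ, m' ξ = m (c • ξ)) :
    ∫⁻ x, ‖𝓕⁻ m' x‖ₑ = ∫⁻ x, ‖𝓕⁻ m x‖ₑ := by
  have key : ∀ x, 𝓕⁻ m' x = |(c ^ Module.finrank ℝ 𝔼)⁻¹| • 𝓕⁻ m (c⁻¹ • x) := by
    intro x
    rw [SchwartzMap.fourierInv_coe, SchwartzMap.fourierInv_coe, Real.fourierInv_eq,
      Real.fourierInv_eq, ← Measure.integral_comp_smul]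
    refine integral_congr_ae (Eventually.of_forall fun v => ?_)
    simp only [h, inner_smul_left, inner_smul_right]
    congr 3
    simp [hc]
  rw [← ofReal_integral_norm_eq_lintegral_enorm (𝓕⁻ m').integrable,
    ← ofReal_integral_norm_eq_lintegral_enorm (𝓕⁻ m).integrable]
  congr 1
  simp only [key, norm_smul]
  rw [integral_const_mul, Measure.integral_comp_smul volume (fun x => ‖𝓕⁻ m x‖)]
  have : c ^ Module.finrank ℝ 𝔼 ≠ 0 := pow_ne_zero _ hc
  simp only [inv_pow, inv_inv, smul_eq_mul, ← mul_assoc, Real.norm_eq_abs, abs_abs]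
  rw [← abs_mul, inv_mul_cancel₀ this, abs_one, one_mul]

theorem lrNorm_fourierMultiplier_le {r : ℝ≥0∞} [Fact (1 ≤ r)] (m : 𝓢(𝔼, ℂ)) (u : 𝓢'(𝔼, F)) :
    lrNorm r (fourierMultiplierCLM F m u) ≤ (1 + ∫⁻ x, ‖𝓕⁻ m x‖ₑ) * lrNorm r u := by
  -- the summand `1` keeps the constant nonzero, so that the right side is `∞` for `u ∉ L^r`
  have hC : (1 + ∫⁻ x, ‖𝓕⁻ m x‖ₑ) ≠ 0 := by simp
  have hC' : (1 + ∫⁻ x, ‖𝓕⁻ m x‖ₑ) ≠ ⊤ :=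
    ENNReal.add_ne_top.2 ⟨ENNReal.one_ne_top, (𝓕⁻ m).integrable.2.ne⟩
  conv_rhs => rw [lrNorm]
  simp only [ENNReal.mul_iInf_of_ne hC hC']
  refine le_iInf₂ fun g hg => ?_
  obtain ⟨h, hh, hn⟩ := exists_Lp_fourierMultiplier m g
  rw [← hg, ← hh, lrNorm_toTemperedDistribution]
  exact hn.trans (by gcongr; exact le_add_self)

/-- Multipliers with a dilated Schwartz symbol are bounded on `L^r`, uniformly in the dilation:
the `L¹` norm of the kernel does not change under dilation. -/
theorem exists_lrNorm_multiplier_le (F : Type*) [NormedAddCommGroup F] [NormedSpace ℂ F]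
    [CompleteSpace F] (r : ℝ≥0∞) [Fact (1 ≤ r)] (m : 𝓢(𝔼, ℂ)) :
    ∃ C : ℝ≥0∞, C ≠ ⊤ ∧ ∀ c : ℝ, 0 < c → ∀ u : 𝓢'(𝔼, F),
      lrNorm r (multiplier (fun ξ => m (c • ξ)) u) ≤ C * lrNorm r u := by
  refine ⟨1 + ∫⁻ x, ‖𝓕⁻ m x‖ₑ,
    ENNReal.add_ne_top.2 ⟨ENNReal.one_ne_top, (𝓕⁻ m).integrable.2.ne⟩, fun c hc u => ?_⟩
  have hc' : c * (2 * Real.pi) ≠ 0 := by positivity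
  set m' : 𝓢(𝔼, ℂ) := SchwartzMap.compCLMOfContinuousLinearEquiv ℂ
    (ContinuousLinearEquiv.smulLeft (Units.mk0 _ hc')) m with hm'
  have h : ∀ ξ, m' ξ = m ((c * (2 * Real.pi)) • ξ) := fun ξ => rfl
  have e : multiplier (F := F) (fun ξ => m (c • ξ)) = fourierMultiplierCLM F m' := by
    rw [multiplier]
    congr 1
    ext ξ
    rw [h, smul_smul]
  rw [e, ← enorm_fourierInv_comp_smul m m' hc' h]
  exact lrNorm_fourierMultiplier_le m' u

end Multiplier

/-! ### Gaussian symbols -/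

section Gaussian

variable {n : ℕ}

local notation "𝔼" => EuclideanSpace ℝ (Fin n)

theorem norm_iteratedFDeriv_exp_le (i : ℕ) (x : ℝ) :
    ‖iteratedFDeriv ℝ i Real.exp x‖ ≤ Real.exp x := by
  rw [norm_iteratedFDeriv_eq_norm_iteratedDeriv, iteratedDeriv_eq_iterate, Real.iter_deriv_exp,
    Real.norm_of_nonneg (Real.exp_pos x).le]

theorem exists_pow_mul_exp_neg_sq_le (N : ℕ) :
    ∃ C : ℝ, ∀ x : ℝ, 0 ≤ x → (1 + x) ^ N * Real.exp (-x ^ 2) ≤ C := by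
  refine ⟨(N.factorial : ℝ) * Real.exp 2, fun x hx => ?_⟩
  have h1 := Real.pow_div_factorial_le_exp (1 + x) (by linarith) N
  rw [div_le_iff₀ (by positivity)] at h1
  calc (1 + x) ^ N * Real.exp (-x ^ 2) ≤ (Real.exp (1 + x) * N.factorial) * Real.exp (-x ^ 2) := by
        gcongr
    _ = N.factorial * Real.exp (1 + x - x ^ 2) := by
        rw [sub_eq_add_neg (1 + x), Real.exp_add (1 + x)]; ring
    _ ≤ _ := by gcongr; nlinarith [sq_nonneg (x - 1)]

/-- The Gaussian satisfies the Schwartz bounds: by the Faà di Bruno estimate its derivatives are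
dominated by a polynomial times the Gaussian itself. -/
theorem gaussian_decay (k l : ℕ) :
    ∃ C : ℝ, ∀ x : 𝔼, ‖x‖ ^ k * ‖iteratedFDeriv ℝ l (fun x : 𝔼 => Real.exp (-‖x‖ ^ 2)) x‖ ≤ C := by
  have hT : Function.HasTemperateGrowth fun x : 𝔼 => -‖x‖ ^ 2 := by fun_prop
  obtain ⟨a, D, hD, hb⟩ := hT.norm_iteratedFDeriv_le_uniform l
  obtain ⟨C, hC⟩ := exists_pow_mul_exp_neg_sq_le (k + a * l)
  refine ⟨l.factorial * (D + 1) ^ l * C, fun x => ?_⟩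
  have hx := norm_nonneg x
  have h := norm_iteratedFDeriv_comp_le (n := l) (N := ∞) Real.contDiff_exp hT.1
    (by exact_mod_cast le_top) x
    (C := Real.exp (-‖x‖ ^ 2)) (D := (D + 1) * (1 + ‖x‖) ^ a)
    (fun i _ => norm_iteratedFDeriv_exp_le i _) (fun i h1 hi => by
      refine (hb i hi x).trans ?_
      have h2 : 1 ≤ (1 + ‖x‖) ^ a := one_le_pow₀ (by linarith)
      refine le_trans ?_ (le_self_pow₀ (by nlinarith) (by omega))
      gcongr
      linarith)
  calc _ ≤ (1 + ‖x‖) ^ k * (l.factorial * Real.exp (-‖x‖ ^ 2) * ((D + 1) * (1 + ‖x‖) ^ a) ^ l) := by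
        gcongr
        · linarith
        · exact h
    _ = l.factorial * (D + 1) ^ l * ((1 + ‖x‖) ^ (k + a * l) * Real.exp (-‖x‖ ^ 2)) := by
        rw [mul_pow, ← pow_mul, pow_add]; ring
    _ ≤ _ := by gcongr; exact hC _ hx

/-- The Gaussian `exp (-|ξ|²)` as a real Schwartz function. -/
noncomputable def gaussianSchwartz (n : ℕ) : 𝓢(EuclideanSpace ℝ (Fin n), ℝ) where
  toFun x := Real.exp (-‖x‖ ^ 2)
  smooth' := Real.contDiff_exp.comp (contDiff_norm_sq ℝ).neg
  decay' := gaussian_decay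

/-- The Schwartz function `|ξ|^{2N} exp (-|ξ|²)`. -/
noncomputable def gaussianMoment (n N : ℕ) : 𝓢(EuclideanSpace ℝ (Fin n), ℂ) :=
  SchwartzMap.smulLeftCLM ℂ (fun ξ => ((‖ξ‖ ^ 2) ^ N : ℝ))
    (SchwartzMap.postcompCLM Complex.ofRealCLM (gaussianSchwartz n))

theorem gaussianMoment_apply (N : ℕ) (ξ : 𝔼) :
    gaussianMoment n N ξ = (((‖ξ‖ ^ 2) ^ N * Real.exp (-‖ξ‖ ^ 2) : ℝ) : ℂ) := by
  rw [gaussianMoment, SchwartzMap.smulLeftCLM_apply_apply (by fun_prop)]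
  have h : SchwartzMap.postcompCLM Complex.ofRealCLM (gaussianSchwartz n) ξ =
    ((Real.exp (-‖ξ‖ ^ 2) : ℝ) : ℂ) := rfl
  rw [h, Complex.real_smul, ← Complex.ofReal_mul]

end Gaussian

/-! ### Truncation of Schwartz functions -/

section Cutoff

variable {E : Type*} [NormedAddCommGroup E] [NormedSpace ℝ E]

/-- Schwartz functions are approximated by their truncations `θ (ε ·) v`, if `θ = 1` near `0`. -/
theorem tendsto_smulLeftCLM_comp_smul {θ : E → ℂ} (hθ : ContDiff ℝ ∞ θ)
    (hθc : HasCompactSupport θ) {c : ℝ} (hc : 0 < c) (h1 : ∀ x, ‖x‖ < c → θ x = 1)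
    (v : 𝓢(E, ℂ)) :
    Tendsto (fun ε : ℝ => SchwartzMap.smulLeftCLM ℂ (fun x => θ (ε • x)) v) (𝓝[>] 0) (𝓝 v) := by
  have hT : ∀ ε : ℝ, Function.HasTemperateGrowth fun x => θ (ε • x) := fun ε =>
    (hθc.hasTemperateGrowth hθ).comp (by fun_prop)
  set η : E → ℂ := fun x => θ x - 1 with hη
  have hηs : ContDiff ℝ ∞ η := hθ.sub contDiff_const
  -- all derivatives of `η` are bounded
  have hηb : ∀ i : ℕ, ∃ B, ∀ x, ‖iteratedFDeriv ℝ i η x‖ ≤ B := by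
    intro i
    obtain ⟨B, hB⟩ := ((hθ.continuous_iteratedFDeriv (m := i)
      (mod_cast le_top)).norm).bounded_above_of_compact_support (hθc.iteratedFDeriv i).norm
    rcases Nat.eq_zero_or_pos i with rfl | hi
    · refine ⟨B + 1, fun x => ?_⟩
      have := hB x
      simp only [norm_iteratedFDeriv_zero, norm_norm] at this ⊢
      refine (norm_sub_le _ _).trans ?_
      simpa using this
    · refine ⟨B, fun x => ?_⟩
      have := hB x
      rw [norm_norm] at this
      rw [show η = θ - fun _ => 1 from rfl,
        iteratedFDeriv_sub_apply (hθ.of_le (mod_cast le_top)).contDiffAt contDiffAt_const,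
        iteratedFDeriv_const_of_ne hi.ne']
      simpa using this
  choose B hB using hηb
  rw [(schwartz_withSeminorms ℝ E ℂ).tendsto_nhds]
  rintro ⟨k, l⟩ δ hδ
  -- the seminorm of the difference is at most `A ε` for `ε ≤ 1`
  set A : ℝ := ∑ i ∈ Finset.range (l + 1), (l.choose i : ℝ) * B i *
    (SchwartzMap.seminorm ℝ (k + 1) (l - i) v / c) with hA
  have hB0 : ∀ i, 0 ≤ B i := fun i => (norm_nonneg _).trans (hB i 0)
  have hA0 : 0 ≤ A := Finset.sum_nonneg fun i _ => by
    have := hB0 i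
    have := apply_nonneg (SchwartzMap.seminorm ℝ (k + 1) (l - i)) v
    positivity
  have hbound : ∀ ε : ℝ, 0 < ε → ε ≤ 1 → SchwartzMap.seminorm ℝ k l
      (SchwartzMap.smulLeftCLM ℂ (fun x => θ (ε • x)) v - v) ≤ A * ε := by
    intro ε hε hε1
    refine SchwartzMap.seminorm_le_bound _ _ _ _ (by positivity) fun x => ?_
    have hfun : ⇑(SchwartzMap.smulLeftCLM ℂ (fun x => θ (ε • x)) v - v) =
        fun x => η (ε • x) • v x := by
      ext y
      rw [sub_apply, SchwartzMap.smulLeftCLM_apply_apply (hT ε), hη]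
      simp only [smul_eq_mul]
      ring
    rw [hfun]
    rcases lt_or_ge (ε * ‖x‖) c with hx | hx
    -- where `ε |x| < c` the difference vanishes; elsewhere `1 ≤ ε |x| / c` yields the factor `ε`
    · have hz : (fun x => η (ε • x) • v x) =ᶠ[𝓝 x] fun _ => 0 := by
        have : ∀ᶠ y in 𝓝 x, ε * ‖y‖ < c :=
          (continuous_const.mul continuous_norm).tendsto x |>.eventually_lt_const hx
        filter_upwards [this] with y hy
        rw [hη]
        simp only
        rw [h1 _ (by rwa [norm_smul, Real.norm_of_nonneg hε.le]), sub_self, zero_smul]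
      rw [(hz.iteratedFDeriv ℝ l).eq_of_nhds]
      have h0 : iteratedFDeriv ℝ l (fun _ : E => (0 : ℂ)) x = 0 := by
        simp [iteratedFDeriv_fun_zero]
      rw [h0, norm_zero, mul_zero]
      positivity
    · have hη' : ContDiff ℝ ∞ fun x => η (ε • x) := hηs.comp (contDiff_const_smul ε)
      refine (mul_le_mul_of_nonneg_left (norm_iteratedFDeriv_smul_le (N := ∞) hη' (v.smooth ⊤) x
        (n := l) (mod_cast le_top)) (by positivity)).trans ?_
      rw [hA, Finset.mul_sum, Finset.sum_mul]
      refine Finset.sum_le_sum fun i _ => ?_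
      have e1 : ‖iteratedFDeriv ℝ i (fun x => η (ε • x)) x‖ ≤ B i := by
        rw [iteratedFDeriv_comp_const_smul ε (hηs.of_le (mod_cast le_top)), norm_smul, norm_pow,
          Real.norm_of_nonneg hε.le]
        exact (mul_le_of_le_one_left (norm_nonneg _) (pow_le_one₀ hε.le hε1)).trans (hB i _)
      have e2 : ‖x‖ ^ k * ‖iteratedFDeriv ℝ (l - i) v x‖ ≤
          SchwartzMap.seminorm ℝ (k + 1) (l - i) v / c * ε := by
        have := SchwartzMap.le_seminorm ℝ (k + 1) (l - i) v x
        rw [div_mul_eq_mul_div, le_div_iff₀ hc]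
        calc _ ≤ ‖x‖ ^ k * ‖iteratedFDeriv ℝ (l - i) v x‖ * (ε * ‖x‖) := by gcongr
          _ = ‖x‖ ^ (k + 1) * ‖iteratedFDeriv ℝ (l - i) v x‖ * ε := by ring
          _ ≤ _ := by gcongr
      calc _ = (l.choose i : ℝ) * ‖iteratedFDeriv ℝ i (fun x => η (ε • x)) x‖ *
            (‖x‖ ^ k * ‖iteratedFDeriv ℝ (l - i) v x‖) := by ring
        _ ≤ (l.choose i : ℝ) * B i * (SchwartzMap.seminorm ℝ (k + 1) (l - i) v / c * ε) := by
            have := hB0 i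
            gcongr
        _ = _ := by ring
  have hlim : Tendsto (fun ε : ℝ => A * ε) (𝓝[>] 0) (𝓝 0) := by
    have : Tendsto (fun ε : ℝ => A * ε) (𝓝 0) (𝓝 (A * 0)) := (continuous_const_mul A).tendsto 0
    rw [mul_zero] at this
    exact this.mono_left nhdsWithin_le_nhds
  filter_upwards [hlim.eventually_lt_const hδ, Ioc_mem_nhdsGT zero_lt_one] with ε h2 h3
  exact (hbound ε h3.1 h3.2).trans_lt h2

end Cutoff

/-! ### Calculus of multipliers -/

section Multipliers

variable {n : ℕ} {F : Type*} [NormedAddCommGroup F] [NormedSpace ℂ F]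

local notation "𝔼" => EuclideanSpace ℝ (Fin n)

theorem multiplier_multiplier {m₁ m₂ : 𝔼 → ℂ} (h₁ : m₁.HasTemperateGrowth)
    (h₂ : m₂.HasTemperateGrowth) (u : 𝓢'(𝔼, F)) :
    multiplier m₁ (multiplier m₂ u) = multiplier (fun ξ => m₁ ξ * m₂ ξ) u := by
  have hπ : Function.HasTemperateGrowth fun ξ : 𝔼 => (2 * Real.pi) • ξ := by fun_prop
  have h := fourierMultiplierCLM_fourierMultiplierCLM_apply (h₂.comp hπ) (h₁.comp hπ) u
  rw [mul_comm (m₂ ∘ _)] at h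
  exact h

theorem multiplier_sub {m₁ m₂ : 𝔼 → ℂ} (h₁ : m₁.HasTemperateGrowth)
    (h₂ : m₂.HasTemperateGrowth) (u : 𝓢'(𝔼, F)) :
    multiplier (fun ξ => m₁ ξ - m₂ ξ) u = multiplier m₁ u - multiplier m₂ u := by
  have hπ : Function.HasTemperateGrowth fun ξ : 𝔼 => (2 * Real.pi) • ξ := by fun_prop
  have h := SchwartzMap.smulLeftCLM_sub (F := ℂ) (h₁.comp hπ) (h₂.comp hπ)
  ext v
  have e : (fun ξ => m₁ ((2 * Real.pi) • ξ) - m₂ ((2 * Real.pi) • ξ)) =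
    (m₁ ∘ fun ξ => (2 * Real.pi) • ξ) - (m₂ ∘ fun ξ => (2 * Real.pi) • ξ) := rfl
  simp only [multiplier, sub_apply, fourierMultiplierCLM_apply_apply]
  rw [e, h, sub_apply, ← FourierTransform.fourierCLM_apply (R := ℂ), map_sub, map_sub]
  rfl

theorem multiplier_const_mul {m : 𝔼 → ℂ} (h : m.HasTemperateGrowth) (c : ℂ) (u : 𝓢'(𝔼, F)) :
    multiplier (fun ξ => c * m ξ) u = c • multiplier m u := by
  simp only [multiplier]
  exact DFunLike.congr_fun (fourierMultiplierCLM_smul (F := F) (h.comp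
    (show Function.HasTemperateGrowth fun ξ : 𝔼 => (2 * Real.pi) • ξ by fun_prop)) c) u

/-- `θ (ε D) u → u` as `ε → 0`, for a cutoff `θ` equal to `1` near the origin. -/
theorem tendsto_multiplier_comp_smul {θ : 𝔼 → ℂ} (hθ : ContDiff ℝ ∞ θ)
    (hθc : HasCompactSupport θ) {c : ℝ} (hc : 0 < c) (h1 : ∀ x, ‖x‖ < c → θ x = 1)
    (u : 𝓢'(𝔼, F)) :
    Tendsto (fun ε : ℝ => multiplier (fun ξ => θ (ε • ξ)) u) (𝓝[>] 0) (𝓝 u) := by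
  rw [PointwiseConvergenceCLM.tendsto_iff_forall_tendsto]
  intro v
  have hpi : 0 < 2 * Real.pi := by positivity
  have h2 : Tendsto (fun ε : ℝ => ε * (2 * Real.pi)) (𝓝[>] 0) (𝓝[>] 0) := by
    refine tendsto_nhdsWithin_iff.2 ⟨?_, ?_⟩
    · have : Tendsto (fun ε : ℝ => ε * (2 * Real.pi)) (𝓝 0) (𝓝 (0 * (2 * Real.pi))) :=
        (continuous_mul_const _).tendsto 0
      rw [zero_mul] at this
      exact this.mono_left nhdsWithin_le_nhds
    · filter_upwards [self_mem_nhdsWithin] with ε hε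
      exact mul_pos hε hpi
  have h := (tendsto_smulLeftCLM_comp_smul hθ hθc hc h1 (FourierTransform.fourierInv v)).comp h2
  have h3 := (u.continuous.comp (FourierTransform.fourierCLM ℂ 𝓢(𝔼, ℂ)).continuous).tendsto
    (FourierTransform.fourierInv v) |>.comp h
  simp only [Function.comp_def, FourierTransform.fourierCLM_apply,
    FourierTransform.fourier_fourierInv_eq] at h3
  simp only [multiplier, fourierMultiplierCLM_apply_apply, smul_smul]
  exact h3

end Multipliers

/-! ### The low frequency cutoff of a dyadic partition -/

section LowPass

variable {n : ℕ} (φ : DyadicPartition n)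

local notation "𝔼" => EuclideanSpace ℝ (Fin n)

theorem DyadicPartition.eq_zero {ξ : 𝔼} (h : ‖ξ‖ < 3 / 4 ∨ 8 / 3 < ‖ξ‖) : φ.toFun ξ = 0 := by
  by_contra hne
  have := φ.tsupport_subset (subset_tsupport _ hne)
  rcases h with h | h
  · exact absurd this.1 (not_le.2 h)
  · exact absurd this.2 (not_le.2 h)

/-- For `8/3 < |ξ| < 6` only the terms `j = 1, 2` of the partition of unity are nonzero. -/
theorem DyadicPartition.sum_eq_one {ξ : 𝔼} (h1 : 8 / 3 < ‖ξ‖) (h2 : ‖ξ‖ < 6) :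
    φ.toFun ((2⁻¹ : ℝ) • ξ) + φ.toFun ((4⁻¹ : ℝ) • ξ) = 1 := by
  have hξ : ξ ≠ 0 := norm_pos_iff.1 (by linarith)
  have hs : HasSum (fun j : ℤ => φ.toFun ((2 : ℝ) ^ (-j) • ξ))
      (∑ j ∈ ({1, 2} : Finset ℤ), φ.toFun ((2 : ℝ) ^ (-j) • ξ)) := by
    refine hasSum_sum_of_ne_finset_zero fun j hj => ?_
    simp only [Finset.mem_insert, Finset.mem_singleton, not_or] at hj
    apply φ.eq_zero
    rw [norm_smul, norm_zpow, Real.norm_ofNat]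
    rcases (by omega : j ≤ 0 ∨ 3 ≤ j) with h | h
    · right
      have : (1 : ℝ) ≤ 2 ^ (-j) := one_le_zpow₀ one_le_two (by omega)
      nlinarith
    · left
      have : (2 : ℝ) ^ (-j) ≤ 2 ^ (-3 : ℤ) := zpow_le_zpow_right₀ one_le_two (by omega)
      have h3 : (2 : ℝ) ^ (-3 : ℤ) = 1 / 8 := by norm_num
      rw [h3] at this
      nlinarith
  have := hs.unique (φ.hasSum ξ hξ)
  rw [Finset.sum_pair (by norm_num)] at this
  have e2 : (2 : ℝ) ^ (-2 : ℤ) = 4⁻¹ := by norm_num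
  rwa [zpow_neg_one, e2] at this

/-- A smooth function equal to `1` on the ball of radius `8/3` and to `0` off the ball of
radius `6`. -/
noncomputable def outerBump (n : ℕ) : ContDiffBump (0 : EuclideanSpace ℝ (Fin n)) :=
  ⟨8 / 3, 6, by norm_num, by norm_num⟩

/-- The low frequency cutoff, equal to `∑_{j < 0} φ (2^{-j} ξ)` for `ξ ≠ 0` and to `1` at `0`. It
vanishes for `|ξ| > 8/3`, and for `|ξ| < 6` it is `1 - ∑_{j = 0}^{2} φ (2^{-j} ξ)`; the definition
glues these two formulas by a bump function, which makes smoothness evident. -/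
noncomputable def DyadicPartition.lowPass (ξ : 𝔼) : ℝ :=
  outerBump n ξ * (1 - φ.toFun ξ - φ.toFun ((2⁻¹ : ℝ) • ξ) - φ.toFun ((4⁻¹ : ℝ) • ξ))

theorem DyadicPartition.contDiff_lowPass : ContDiff ℝ ∞ φ.lowPass := by
  have h := φ.contDiff
  have hs : ∀ c : ℝ, ContDiff ℝ ∞ fun ξ : 𝔼 => φ.toFun (c • ξ) := fun c =>
    h.comp (contDiff_const_smul c)
  exact (outerBump n).contDiff.mul (((contDiff_const.sub h).sub (hs _)).sub (hs _))

theorem DyadicPartition.hasCompactSupport_lowPass : HasCompactSupport φ.lowPass :=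
  (outerBump n).hasCompactSupport.mul_right

theorem outerBump_eq_one {ξ : 𝔼} (h : ‖ξ‖ ≤ 8 / 3) : outerBump n ξ = 1 :=
  (outerBump n).one_of_mem_closedBall (by simpa [outerBump] using h)

theorem outerBump_eq_zero {ξ : 𝔼} (h : 6 ≤ ‖ξ‖) : outerBump n ξ = 0 :=
  (outerBump n).zero_of_le_dist (by simpa [outerBump] using h)

theorem DyadicPartition.lowPass_eq_one {ξ : 𝔼} (h : ‖ξ‖ < 3 / 4) : φ.lowPass ξ = 1 := by
  have hn := norm_nonneg ξ
  rw [DyadicPartition.lowPass, outerBump_eq_one (by linarith), φ.eq_zero (.inl h),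
    φ.eq_zero (.inl _), φ.eq_zero (.inl _)]
  · norm_num
  all_goals
    rw [norm_smul, norm_inv, Real.norm_ofNat]
    linarith

theorem DyadicPartition.lowPass_eq_zero {ξ : 𝔼} (h : 8 / 3 < ‖ξ‖) : φ.lowPass ξ = 0 := by
  rw [DyadicPartition.lowPass]
  rcases lt_or_ge ‖ξ‖ 6 with h6 | h6
  · rw [φ.eq_zero (.inr h), sub_zero, sub_sub, φ.sum_eq_one h h6, sub_self, mul_zero]
  · rw [outerBump_eq_zero h6, zero_mul]

/-- The identity that makes the Littlewood–Paley sum telescope. -/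
theorem DyadicPartition.toFun_eq_lowPass_sub (ξ : 𝔼) :
    φ.toFun ξ = φ.lowPass ((2⁻¹ : ℝ) • ξ) - φ.lowPass ξ := by
  have hn := norm_nonneg ξ
  have n2 : ∀ ξ : 𝔼, ‖(2⁻¹ : ℝ) • ξ‖ = 2⁻¹ * ‖ξ‖ := fun ξ => by
    rw [norm_smul, norm_inv, Real.norm_ofNat]
  have n4 : ∀ ξ : 𝔼, ‖(4⁻¹ : ℝ) • ξ‖ = 4⁻¹ * ‖ξ‖ := fun ξ => by
    rw [norm_smul, norm_inv, Real.norm_ofNat]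
  have e4 : (2⁻¹ : ℝ) • (2⁻¹ : ℝ) • ξ = (4⁻¹ : ℝ) • ξ := by rw [smul_smul]; norm_num
  have e8 : φ.lowPass ((2⁻¹ : ℝ) • ξ) = outerBump n ((2⁻¹ : ℝ) • ξ) * (1 - φ.toFun ((2⁻¹ : ℝ) • ξ) -
      φ.toFun ((4⁻¹ : ℝ) • ξ) - φ.toFun ((4⁻¹ : ℝ) • (2⁻¹ : ℝ) • ξ)) := by
    rw [DyadicPartition.lowPass, e4]
  rcases le_or_gt ‖ξ‖ (8 / 3) with h | h
  · rw [e8, φ.eq_zero (ξ := (4⁻¹ : ℝ) • (2⁻¹ : ℝ) • ξ) (.inl (by rw [n4, n2]; linarith)),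
      outerBump_eq_one (by rw [n2]; linarith), DyadicPartition.lowPass, outerBump_eq_one h]
    ring
  rw [φ.eq_zero (.inr h), φ.lowPass_eq_zero h, sub_zero]
  rcases le_or_gt ‖ξ‖ (16 / 3) with h' | h'
  · rw [e8, φ.eq_zero (ξ := (4⁻¹ : ℝ) • (2⁻¹ : ℝ) • ξ) (.inl (by rw [n4, n2]; linarith)), sub_zero,
      sub_sub, φ.sum_eq_one h (by linarith), sub_self, mul_zero]
  · rw [φ.lowPass_eq_zero (by rw [n2]; linarith)]

/-- The low frequency cutoff as a complex symbol. -/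
noncomputable def DyadicPartition.lowPassC (ξ : 𝔼) : ℂ := φ.lowPass ξ

theorem DyadicPartition.contDiff_lowPassC : ContDiff ℝ ∞ φ.lowPassC :=
  Complex.ofRealCLM.contDiff.comp φ.contDiff_lowPass

theorem DyadicPartition.hasCompactSupport_lowPassC :
    HasCompactSupport φ.lowPassC :=
  φ.hasCompactSupport_lowPass.comp_left (g := Complex.ofReal) rfl

theorem dyadicBlock_eq_sub {F : Type*} [NormedAddCommGroup F] [NormedSpace ℂ F]
    (f : 𝓢'(𝔼, F)) (j : ℤ) :
    dyadicBlock φ j f = multiplier (fun ξ => φ.lowPassC ((2 : ℝ) ^ (-(j + 1)) • ξ)) f -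
      multiplier (fun ξ => φ.lowPassC ((2 : ℝ) ^ (-j) • ξ)) f := by
  have hT : ∀ c : ℝ, Function.HasTemperateGrowth fun ξ => φ.lowPassC (c • ξ) := fun c =>
    (φ.hasCompactSupport_lowPassC.hasTemperateGrowth φ.contDiff_lowPassC).comp (by fun_prop)
  rw [dyadicBlock, ← multiplier_sub (hT _) (hT _)]
  congr 2
  ext ξ
  rw [φ.toFun_eq_lowPass_sub, smul_smul, neg_add, zpow_add₀ two_ne_zero, zpow_neg_one,
    mul_comm, Complex.ofReal_sub]
  rfl

end LowPass

/-! ### Series of distributions and the Littlewood–Paley decomposition -/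

section Series

variable {n : ℕ} {F : Type*} [NormedAddCommGroup F] [NormedSpace ℂ F] [CompleteSpace F]

local notation "𝔼" => EuclideanSpace ℝ (Fin n)

theorem exists_toTemperedDistribution_eq {r : ℝ≥0∞} [Fact (1 ≤ r)] {u : 𝓢'(𝔼, F)}
    (h : lrNorm r u ≠ ⊤) : ∃ g : Lp F r (volume : Measure 𝔼), Lp.toTemperedDistribution g = u := by
  by_contra! hne
  refine h ?_
  simp only [lrNorm]
  exact iInf_eq_top.2 fun g => iInf_eq_top.2 fun hg => absurd hg (hne g)

theorem lrNorm_smul_le {r : ℝ≥0∞} [Fact (1 ≤ r)] {c : ℂ} (hc : c ≠ 0) (u : 𝓢'(𝔼, F)) :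
    lrNorm r (c • u) ≤ ‖c‖ₑ * lrNorm r u := by
  by_cases h : lrNorm r u = ⊤
  · rw [h, ENNReal.mul_top (by simpa using hc)]; exact le_top
  · obtain ⟨g, rfl⟩ := exists_toTemperedDistribution_eq h
    have e : c • Lp.toTemperedDistribution g = Lp.toTemperedDistribution (c • g) :=
      (map_smul (Lp.toTemperedDistributionCLM F volume r) c g).symm
    rw [e, lrNorm_toTemperedDistribution, lrNorm_toTemperedDistribution, enorm_smul]

/-- Convergence to `0` in the `L^r` norm implies convergence to `0` in `𝓢'`. -/
theorem tendsto_zero_of_lrNorm {ι : Type*} {l : Filter ι} {r : ℝ≥0∞} [Fact (1 ≤ r)]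
    {u : ι → 𝓢'(𝔼, F)} (h : Tendsto (fun i => lrNorm r (u i)) l (𝓝 0)) : Tendsto u l (𝓝 0) := by
  classical
  set g : ι → Lp F r (volume : Measure 𝔼) := fun i =>
    if hi : lrNorm r (u i) ≠ ⊤ then (exists_toTemperedDistribution_eq hi).choose else 0 with hg
  have hfin : ∀ᶠ i in l, Lp.toTemperedDistribution (g i) = u i := by
    filter_upwards [h.eventually_lt_const ENNReal.zero_lt_top] with i hi
    simp only [hg, dif_pos hi.ne]
    exact (exists_toTemperedDistribution_eq hi.ne).choose_spec
  have h0 : Tendsto g l (𝓝 0) := by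
    rw [tendsto_zero_iff_enorm_tendsto_zero]
    refine h.congr' ?_
    filter_upwards [hfin] with i hi
    rw [← hi, lrNorm_toTemperedDistribution]
  have h1 := ((Lp.toTemperedDistributionCLM F volume r).continuous.tendsto 0).comp h0
  rw [map_zero] at h1
  exact h1.congr' hfin

/-- The triangle inequality for a series that converges in `𝓢'` along some sequence of finite
partial sums. -/
theorem lrNorm_le_tsum {ι κ : Type*} {r : ℝ≥0∞} [Fact (1 ≤ r)] {T : ι → 𝓢'(𝔼, F)} {u : 𝓢'(𝔼, F)}
    {l : Filter κ} [l.NeBot] {s : κ → Finset ι} (hs : Tendsto s l atTop)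
    (hu : Tendsto (fun k => ∑ i ∈ s k, T i) l (𝓝 u)) :
    lrNorm r u ≤ ∑' i, lrNorm r (T i) := by
  by_cases hfin : ∑' i, lrNorm r (T i) = ⊤
  · rw [hfin]; exact le_top
  choose g hg using fun i => exists_toTemperedDistribution_eq (ENNReal.ne_top_of_tsum_ne_top hfin i)
  have hn : ∀ i, lrNorm r (T i) = ‖g i‖ₑ := fun i => by
    rw [← hg i, lrNorm_toTemperedDistribution]
  simp only [hn] at hfin ⊢
  have hsum : Summable g := .of_enorm hfin
  have h1 : HasSum T (Lp.toTemperedDistribution (∑' i, g i)) := by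
    have := hsum.hasSum.mapL (Lp.toTemperedDistributionCLM F volume r)
    simpa only [Lp.toTemperedDistributionCLM_apply, hg] using this
  rw [tendsto_nhds_unique hu (h1.comp hs), lrNorm_toTemperedDistribution]
  exact enorm_tsum_le_tsum_enorm

theorem sum_Ico_neg_sub {M : Type*} [AddCommGroup M] (a : ℤ → M) (J : ℕ) :
    ∑ j ∈ Finset.Ico (-J : ℤ) J, (a (j + 1) - a j) = a J - a (-J) := by
  induction J with
  | zero => simp
  | succ J ih =>
    have h : Finset.Ico (-((J + 1 : ℕ) : ℤ)) ((J + 1 : ℕ) : ℤ) =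
        insert (J : ℤ) (insert (-(J : ℤ) - 1) (Finset.Ico (-J : ℤ) J)) := by
      ext j
      simp only [Finset.mem_Ico, Finset.mem_insert]
      omega
    rw [h, Finset.sum_insert (by simp; omega), Finset.sum_insert (by simp), ih, sub_add_cancel]
    have e1 : (-((J + 1 : ℕ) : ℤ)) = -(J : ℤ) - 1 := by omega
    rw [e1, Nat.cast_succ]
    abel

/-- The homogeneous Littlewood–Paley decomposition of an element of `𝓢'_h`. -/
theorem tendsto_sum_dyadicBlock (φ : DyadicPartition n) {f : 𝓢'(𝔼, F)}
    (hf : f ∈ homogeneousDistributions n F) :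
    Tendsto (fun J : ℕ => ∑ j ∈ Finset.Ico (-J : ℤ) J, dyadicBlock φ j f) atTop (𝓝 f) := by
  have hp : Tendsto (fun J : ℕ => (2 : ℝ) ^ (J : ℤ)) atTop atTop := by
    simpa only [zpow_natCast] using tendsto_pow_atTop_atTop_of_one_lt (one_lt_two (α := ℝ))
  have hhigh : Tendsto (fun J : ℕ => multiplier (fun ξ => φ.lowPassC ((2 : ℝ) ^ (-(J : ℤ)) • ξ)) f)
      atTop (𝓝 f) := by
    have h := tendsto_multiplier_comp_smul φ.contDiff_lowPassC φ.hasCompactSupport_lowPassC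
      (c := 3 / 4) (by norm_num)
      (fun ξ hξ => by rw [DyadicPartition.lowPassC, φ.lowPass_eq_one hξ, Complex.ofReal_one]) f
    have h2 : Tendsto (fun J : ℕ => (2 : ℝ) ^ (-(J : ℤ))) atTop (𝓝[>] 0) := by
      simpa only [zpow_neg, Function.comp_def] using tendsto_inv_atTop_nhdsGT_zero.comp hp
    exact h.comp h2
  have hlow : Tendsto (fun J : ℕ => multiplier
      (fun ξ => φ.lowPassC ((2 : ℝ) ^ (-(-(J : ℤ))) • ξ)) f) atTop (𝓝 0) := by
    simp only [neg_neg]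
    exact tendsto_zero_of_lrNorm
      ((hf φ.lowPassC φ.contDiff_lowPassC φ.hasCompactSupport_lowPassC).comp hp)
  have hlim := hhigh.sub hlow
  rw [sub_zero] at hlim
  refine hlim.congr fun J => ?_
  simp only [dyadicBlock_eq_sub]
  exact (sum_Ico_neg_sub (fun j : ℤ => multiplier (fun ξ => φ.lowPassC ((2 : ℝ) ^ (-j) • ξ)) f)
    J).symm

end Series

/-! ### Factorizations of the dyadic and heat symbols -/

section Symbols

variable {n : ℕ}

local notation "𝔼" => EuclideanSpace ℝ (Fin n)

theorem norm_zpow_neg_smul_sq (j : ℤ) (ξ : 𝔼) :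
    ‖(2 : ℝ) ^ (-j) • ξ‖ ^ 2 = (4 : ℝ) ^ (-j) * ‖ξ‖ ^ 2 := by
  rw [norm_smul, norm_zpow, Real.norm_ofNat, mul_pow, ← zpow_natCast, ← zpow_mul, mul_comm (-j),
    zpow_mul]
  norm_num

theorem norm_sqrt_smul_sq {t : ℝ} (ht : 0 ≤ t) (ξ : 𝔼) : ‖√t • ξ‖ ^ 2 = t * ‖ξ‖ ^ 2 := by
  rw [norm_smul, Real.norm_of_nonneg (Real.sqrt_nonneg t), mul_pow, Real.sq_sqrt ht]

theorem heat_symbol_eq {t : ℝ} (ht : 0 ≤ t) (ξ : 𝔼) :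
    (Real.exp (-t * ‖ξ‖ ^ 2) : ℂ) = gaussianMoment n 0 (√t • ξ) := by
  rw [gaussianMoment_apply, norm_sqrt_smul_sq ht, pow_zero, one_mul, neg_mul]

theorem hasTemperateGrowth_comp_smul (m : 𝓢(𝔼, ℂ)) (c : ℝ) :
    Function.HasTemperateGrowth fun ξ => m (c • ξ) :=
  m.hasTemperateGrowth.comp (by fun_prop)

theorem hasTemperateGrowth_heat_symbol {t : ℝ} (ht : 0 ≤ t) :
    Function.HasTemperateGrowth fun ξ : 𝔼 => (Real.exp (-t * ‖ξ‖ ^ 2) : ℂ) := by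
  simp only [heat_symbol_eq ht]
  exact hasTemperateGrowth_comp_smul _ _

variable (φ : DyadicPartition n)

theorem DyadicPartition.hasCompactSupport : HasCompactSupport φ.toFun :=
  HasCompactSupport.of_support_subset_isCompact (isCompact_closedBall 0 (8 / 3)) fun ξ hξ => by
    simpa using (φ.tsupport_subset (subset_tsupport _ hξ)).2

/-- The symbol `φ (ξ) exp (|ξ|²)`, which recovers the block `Δ_0` from `e^{Δ}`. -/
noncomputable def DyadicPartition.backwardSymbol : 𝓢(𝔼, ℂ) :=
  (φ.hasCompactSupport.mul_right (f' := fun ξ => Real.exp (‖ξ‖ ^ 2))).comp_left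
    (g := Complex.ofReal) rfl |>.toSchwartzMap
    (Complex.ofRealCLM.contDiff.comp (φ.contDiff.mul (Real.contDiff_exp.comp (contDiff_norm_sq ℝ))))

theorem DyadicPartition.backwardSymbol_apply (ξ : 𝔼) :
    φ.backwardSymbol ξ = ((φ.toFun ξ * Real.exp (‖ξ‖ ^ 2) : ℝ) : ℂ) := rfl

theorem dyadicBlock_eq_backwardSymbol {F : Type*} [NormedAddCommGroup F] [NormedSpace ℂ F] (j : ℤ)
    (f : 𝓢'(𝔼, F)) :
    dyadicBlock φ j f =
      multiplier (fun ξ => φ.backwardSymbol ((2 : ℝ) ^ (-j) • ξ)) (heat ((4 : ℝ) ^ (-j)) f) := by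
  rw [heat, multiplier_multiplier (hasTemperateGrowth_comp_smul _ _)
    (hasTemperateGrowth_heat_symbol (by positivity)), dyadicBlock]
  congr 2
  ext ξ
  rw [φ.backwardSymbol_apply, ← Complex.ofReal_mul, norm_zpow_neg_smul_sq, mul_assoc,
    ← Real.exp_add, neg_mul, add_neg_cancel, Real.exp_zero, mul_one]

/-- A smooth function equal to `1` at the origin and to `0` off the ball of radius `3/4`. -/
noncomputable def innerBump (n : ℕ) : ContDiffBump (0 : EuclideanSpace ℝ (Fin n)) :=
  ⟨1 / 2, 3 / 4, by norm_num, by norm_num⟩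

theorem norm_sq_add_innerBump_pos (ξ : 𝔼) : 0 < ‖ξ‖ ^ 2 + innerBump n ξ := by
  rcases eq_or_ne ξ 0 with rfl | h
  · rw [(innerBump n).one_of_mem_closedBall (by simp [innerBump])]
    positivity
  · have := norm_pos_iff.2 h
    have := (innerBump n).nonneg (x := ξ)
    positivity

/-- A compactly supported smooth symbol equal to `|ξ|^{-2N}` on the annulus `3/4 ≤ |ξ| ≤ 8/3`;
adding `innerBump` to `|ξ|²` removes the singularity at the origin. -/
noncomputable def inversePowerSymbol (n N : ℕ) : 𝓢(EuclideanSpace ℝ (Fin n), ℂ) :=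
  ((outerBump n).hasCompactSupport.mul_right
    (f' := fun ξ => ((‖ξ‖ ^ 2 + innerBump n ξ) ^ N)⁻¹)).comp_left
    (g := Complex.ofReal) rfl |>.toSchwartzMap
    (Complex.ofRealCLM.contDiff.comp ((outerBump n).contDiff.mul
      ((((contDiff_norm_sq ℝ).add (innerBump n).contDiff).pow N).inv fun ξ =>
        (pow_pos (norm_sq_add_innerBump_pos ξ) N).ne')))

theorem inversePowerSymbol_apply (N : ℕ) {ξ : 𝔼} (h1 : 3 / 4 ≤ ‖ξ‖) (h2 : ‖ξ‖ ≤ 8 / 3) :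
    inversePowerSymbol n N ξ = ((((‖ξ‖ ^ 2) ^ N)⁻¹ : ℝ) : ℂ) := by
  have e : inversePowerSymbol n N ξ =
    ((outerBump n ξ * ((‖ξ‖ ^ 2 + innerBump n ξ) ^ N)⁻¹ : ℝ) : ℂ) := rfl
  rw [e, outerBump_eq_one h2, (innerBump n).zero_of_le_dist (by simpa [innerBump] using h1),
    add_zero, one_mul]

/-- On the frequency annulus of `Δ_j`, the heat symbol gains the factor `(t 4^j)^{-N}` at the cost
of two dilated Schwartz symbols. The case `N = 0` is included. -/
theorem heat_dyadicBlock_eq {F : Type*} [NormedAddCommGroup F] [NormedSpace ℂ F] (N : ℕ) {t : ℝ}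
    (ht : 0 < t) (j : ℤ) (f : 𝓢'(𝔼, F)) :
    heat t (dyadicBlock φ j f) = ((((t * (4 : ℝ) ^ j) ^ N)⁻¹ : ℝ) : ℂ) •
      multiplier (fun ξ => gaussianMoment n N (√t • ξ))
        (multiplier (fun ξ => inversePowerSymbol n N ((2 : ℝ) ^ (-j) • ξ))
          (dyadicBlock φ j f)) := by
  have hφ : Function.HasTemperateGrowth fun ξ : 𝔼 => (φ.toFun ((2 : ℝ) ^ (-j) • ξ) : ℂ) := by
    have h : Function.HasTemperateGrowth φ.toFun :=
      φ.hasCompactSupport.hasTemperateGrowth φ.contDiff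
    exact Function.Complex.hasTemperateGrowth_ofReal.comp (h.comp (by fun_prop))
  have hg := hasTemperateGrowth_comp_smul (gaussianMoment n N) √t
  have hp := hasTemperateGrowth_comp_smul (inversePowerSymbol n N) ((2 : ℝ) ^ (-j))
  have hpφ : Function.HasTemperateGrowth fun ξ : 𝔼 =>
      inversePowerSymbol n N ((2 : ℝ) ^ (-j) • ξ) * (φ.toFun ((2 : ℝ) ^ (-j) • ξ) : ℂ) := hp.mul hφ
  have hgpφ : Function.HasTemperateGrowth fun ξ : 𝔼 => gaussianMoment n N (√t • ξ) *
      (inversePowerSymbol n N ((2 : ℝ) ^ (-j) • ξ) * (φ.toFun ((2 : ℝ) ^ (-j) • ξ) : ℂ)) :=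
    hg.mul hpφ
  rw [dyadicBlock, heat, multiplier_multiplier (hasTemperateGrowth_heat_symbol ht.le) hφ,
    multiplier_multiplier hp hφ, multiplier_multiplier hg hpφ, ← multiplier_const_mul hgpφ]
  congr 2
  ext ξ
  rcases eq_or_ne (φ.toFun ((2 : ℝ) ^ (-j) • ξ)) 0 with h | h
  · simp only [h, Complex.ofReal_zero, mul_zero]
  obtain ⟨h1, h2⟩ := φ.tsupport_subset (subset_tsupport _ h)
  have hξ : ‖ξ‖ ≠ 0 := by
    rintro h0
    rw [norm_smul, h0, mul_zero] at h1
    norm_num at h1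
  rw [gaussianMoment_apply, inversePowerSymbol_apply N h1 h2, norm_sqrt_smul_sq ht.le,
    norm_zpow_neg_smul_sq]
  simp only [← Complex.ofReal_mul]
  congr 1
  have h4 : (4 : ℝ) ^ j ≠ 0 := by positivity
  have e4 : (4 : ℝ) ^ (-j) = ((4 : ℝ) ^ j)⁻¹ := zpow_neg _ _
  rw [e4]
  generalize φ.toFun ((2 : ℝ) ^ (-j) • ξ) = y
  field_simp
  rw [mul_assoc, ← mul_pow]
  field_simp

end Symbols

/-! ### Comparison of dyadic blocks with the heat flow -/

section Estimates

variable {n : ℕ} (φ : DyadicPartition n) (F : Type*) [NormedAddCommGroup F] [NormedSpace ℂ F]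
  [CompleteSpace F] (r : ℝ≥0∞) [Fact (1 ≤ r)]

local notation "𝔼" => EuclideanSpace ℝ (Fin n)

/-- The dyadic block `Δ_j f` is controlled by the heat flow at time `4^{-j}`. -/
theorem exists_lrNorm_dyadicBlock_le :
    ∃ C : ℝ≥0∞, C ≠ ⊤ ∧ ∀ (j : ℤ) (f : 𝓢'(𝔼, F)),
      lrNorm r (dyadicBlock φ j f) ≤ C * lrNorm r (heat ((4 : ℝ) ^ (-j)) f) := by
  obtain ⟨C, hC, h⟩ := exists_lrNorm_multiplier_le F r φ.backwardSymbol
  refine ⟨C, hC, fun j f => ?_⟩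
  rw [dyadicBlock_eq_backwardSymbol]
  exact h _ (by positivity) _

/-- The heat flow decays on the dyadic block `Δ_j f`, with a constant independent of `t`
and `j`. -/
theorem exists_lrNorm_heat_dyadicBlock_le (N : ℕ) :
    ∃ C : ℝ≥0∞, C ≠ ⊤ ∧ ∀ (t : ℝ), 0 < t → ∀ (j : ℤ) (f : 𝓢'(𝔼, F)),
      lrNorm r (heat t (dyadicBlock φ j f)) ≤
        C * (ENNReal.ofReal ((t * (4 : ℝ) ^ j) ^ N)⁻¹ * lrNorm r (dyadicBlock φ j f)) := by
  obtain ⟨C₁, hC₁, h₁⟩ := exists_lrNorm_multiplier_le F r (gaussianMoment n N)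
  obtain ⟨C₂, hC₂, h₂⟩ := exists_lrNorm_multiplier_le F r (inversePowerSymbol n N)
  refine ⟨C₁ * C₂, ENNReal.mul_ne_top hC₁ hC₂, fun t ht j f => ?_⟩
  have hc : 0 < ((t * (4 : ℝ) ^ j) ^ N)⁻¹ := by positivity
  rw [heat_dyadicBlock_eq φ N ht j f]
  refine (lrNorm_smul_le (by exact_mod_cast hc.ne') _).trans ?_
  rw [← ofReal_norm, Complex.norm_of_nonneg hc.le]
  calc _ ≤ ENNReal.ofReal ((t * (4 : ℝ) ^ j) ^ N)⁻¹ *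
        (C₁ * (C₂ * lrNorm r (dyadicBlock φ j f))) := by
        gcongr
        refine (h₁ _ (Real.sqrt_pos.2 ht) _).trans ?_
        gcongr
        exact h₂ _ (by positivity) _
    _ = _ := by ring

end Estimates

/-! ### Summation over dyadic scales -/

section Weights

/-- The weight `(t 4^j)^{s/2} min (1, (t 4^j)^{-N})`, `N ≥ s`, decays geometrically away from
`t 4^j = 1`. The exponent `M` selects the term that attains the minimum, and the factor
`4 ^ (s / 2)` pays for rounding `log₄ t`. -/
theorem exists_rpow_mul_le {s t : ℝ} (hs : 0 < s) (ht : 0 < t) {N : ℕ} (hN : s ≤ N) (j : ℤ) :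
    ∃ M : ℕ, (M = 0 ∨ M = N) ∧ t ^ (s / 2) * ((t * (4 : ℝ) ^ j) ^ M)⁻¹ ≤
      4 ^ (s / 2) * 4 ^ (-(s / 2) * |((j + ⌊Real.logb 4 t⌋ : ℤ) : ℝ)|) * 2 ^ ((j : ℝ) * -s) := by
  set τ := Real.logb 4 t with hτ
  have h4 : (0 : ℝ) < 4 := by norm_num
  have et : t = 4 ^ τ := (Real.rpow_logb h4 (by norm_num) ht).symm
  have e2 : (2 : ℝ) ^ ((j : ℝ) * -s) = 4 ^ (-(j * (s / 2)) : ℝ) := by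
    rw [show (4 : ℝ) = 2 ^ (2 : ℝ) by norm_num, ← Real.rpow_mul two_pos.le]
    congr 1
    ring
  have eL : ∀ M : ℕ, t ^ (s / 2) * ((t * (4 : ℝ) ^ j) ^ M)⁻¹ =
      4 ^ (τ * (s / 2) - (τ + j) * M) := fun M => by
    rw [et, ← Real.rpow_intCast, ← Real.rpow_add h4, ← Real.rpow_natCast, ← Real.rpow_mul h4.le,
      ← Real.rpow_mul h4.le, ← Real.rpow_neg h4.le, ← Real.rpow_add h4, sub_eq_add_neg]
  have hfl := Int.floor_le τ
  have hlt := Int.lt_floor_add_one τ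
  have habs : |((j + ⌊τ⌋ : ℤ) : ℝ)| ≤ 1 + |τ + j| := by
    push_cast
    calc |(j : ℝ) + ⌊τ⌋| = |(⌊τ⌋ - τ) + (τ + j)| := by ring_nf
      _ ≤ |⌊τ⌋ - τ| + |τ + j| := abs_add_le _ _
      _ ≤ _ := by
        gcongr
        rw [abs_le]
        constructor <;> linarith
  have hR : (4 : ℝ) ^ (-(s / 2) * |τ + j| - j * (s / 2)) ≤
      4 ^ (s / 2) * 4 ^ (-(s / 2) * |((j + ⌊τ⌋ : ℤ) : ℝ)|) * 2 ^ ((j : ℝ) * -s) := by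
    rw [e2, ← Real.rpow_add h4, ← Real.rpow_add h4]
    refine Real.rpow_le_rpow_of_exponent_le (by norm_num) ?_
    nlinarith
  rcases le_total (τ + j) 0 with h | h
  · refine ⟨0, .inl rfl, (le_of_eq ?_).trans hR⟩
    rw [eL, abs_of_nonpos h]
    congr 1
    push_cast
    ring
  · refine ⟨N, .inr rfl, le_trans ?_ hR⟩
    rw [eL, abs_of_nonneg h]
    refine Real.rpow_le_rpow_of_exponent_le (by norm_num) ?_
    nlinarith [mul_le_mul_of_nonneg_left hN h]

theorem tsum_ofReal_rpow_abs_ne_top {c : ℝ} (hc : 0 < c) :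
    ∑' i : ℤ, ENNReal.ofReal (4 ^ (-c * |(i : ℝ)|)) ≠ ⊤ := by
  have hq : (4 : ℝ) ^ (-c) < 1 := Real.rpow_lt_one_of_one_lt_of_neg (by norm_num) (by linarith)
  have hq0 : (0 : ℝ) ≤ 4 ^ (-c) := by positivity
  have hnat : Summable fun i : ℕ => ((4 : ℝ) ^ (-c)) ^ i := summable_geometric_of_lt_one hq0 hq
  have h : Summable fun i : ℤ => (4 : ℝ) ^ (-c * |(i : ℝ)|) := by
    refine .of_nat_of_neg ?_ ?_ <;>
    · refine hnat.congr fun i => ?_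
      rw [← Real.rpow_natCast, ← Real.rpow_mul (by norm_num)]
      simp
  exact h.tsum_ofReal_ne_top

/-- Averages of a bounded sequence that tends to `0` at `-∞` tend to `0` as the summable weight is
moved to `-∞`, by dominated convergence for the counting measure. -/
theorem tendsto_tsum_mul_shift {w a : ℤ → ℝ≥0∞} (hw : ∑' i, w i ≠ ⊤) (ha : ⨆ j, a j < ⊤)
    (ha0 : Tendsto a atBot (𝓝 0)) :
    Tendsto (fun k : ℤ => ∑' j, w (j + k) * a j) atTop (𝓝 0) := by
  have e : ∀ k : ℤ, ∑' j, w (j + k) * a j = ∑' i, w i * a (i - k) := fun k => by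
    rw [← (Equiv.addRight k).tsum_eq fun i => w i * a (i - k)]
    simp
  have hwi : ∀ i, w i ≠ ⊤ := ENNReal.ne_top_of_tsum_ne_top hw
  simp only [e, ← lintegral_count]
  have h := tendsto_lintegral_filter_of_dominated_convergence (μ := (Measure.count : Measure ℤ))
    (l := atTop) (F := fun (k : ℤ) i => w i * a (i - k)) (f := fun _ => 0)
    (fun i => w i * ⨆ j, a j) (.of_forall fun k => measurable_of_countable _)
    (.of_forall fun k => .of_forall fun i => by gcongr; exact le_iSup a _)
    (by rw [lintegral_count, ENNReal.tsum_mul_right]; exact ENNReal.mul_ne_top hw ha.ne)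
    (.of_forall fun i => by
      have h1 : Tendsto (fun k : ℤ => i - k) atTop atBot :=
        tendsto_atBot_add_const_left _ i tendsto_neg_atTop_atBot
      have := ENNReal.Tendsto.const_mul (ha0.comp h1) (.inr (hwi i))
      rwa [mul_zero] at this)
  simpa using h

end Weights

/-! ### The two implications -/

section Equivalence

theorem tendsto_heat_of_besovC0 {n : ℕ} {F : Type*} [NormedAddCommGroup F] [NormedSpace ℂ F]
    [CompleteSpace F] {φ : DyadicPartition n} {r : ℝ≥0∞} [Fact (1 ≤ r)]
    {s : ℝ} (hs : 0 < s) {f : 𝓢'(EuclideanSpace ℝ (Fin n), F)} (hf : f ∈ besovC0 φ F (-s) r) :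
    Tendsto (fun t : ℝ => ENNReal.ofReal (t ^ (s / 2)) * lrNorm r (heat t f)) atTop (𝓝 0) := by
  obtain ⟨N, hN⟩ := exists_nat_ge s
  obtain ⟨C₀, hC₀, h₀⟩ := exists_lrNorm_heat_dyadicBlock_le φ F r 0
  obtain ⟨C₁, hC₁, h₁⟩ := exists_lrNorm_heat_dyadicBlock_le φ F r N
  set C := max C₀ C₁ with hC
  have hCt : C ≠ ⊤ := (max_lt hC₀.lt_top hC₁.lt_top).ne
  set w : ℤ → ℝ≥0∞ := fun i => ENNReal.ofReal (4 ^ (-(s / 2) * |(i : ℝ)|)) with hw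
  set D := C * ENNReal.ofReal (4 ^ (s / 2)) with hD
  have hDt : D ≠ ⊤ := ENNReal.mul_ne_top hCt ENNReal.ofReal_ne_top
  have hblock : ∀ t : ℝ, 0 < t → ∀ j : ℤ,
      ENNReal.ofReal (t ^ (s / 2)) * lrNorm r (heat t (dyadicBlock φ j f)) ≤
        D * (w (j + ⌊Real.logb 4 t⌋) * besovTerm φ (-s) r f j) := by
    intro t ht j
    obtain ⟨M, hM, hle⟩ := exists_rpow_mul_le hs ht hN j
    have hb : lrNorm r (heat t (dyadicBlock φ j f)) ≤
        C * (ENNReal.ofReal ((t * (4 : ℝ) ^ j) ^ M)⁻¹ * lrNorm r (dyadicBlock φ j f)) := by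
      rcases hM with rfl | rfl
      · refine (h₀ t ht j f).trans ?_
        gcongr
        exact le_max_left _ _
      · refine (h₁ t ht j f).trans ?_
        gcongr
        exact le_max_right _ _
    calc _ ≤ ENNReal.ofReal (t ^ (s / 2)) *
          (C * (ENNReal.ofReal ((t * (4 : ℝ) ^ j) ^ M)⁻¹ * lrNorm r (dyadicBlock φ j f))) := by
          gcongr
      _ = C * (ENNReal.ofReal (t ^ (s / 2) * ((t * (4 : ℝ) ^ j) ^ M)⁻¹) *
            lrNorm r (dyadicBlock φ j f)) := by
          rw [ENNReal.ofReal_mul (by positivity)]; ring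
      _ ≤ C * (ENNReal.ofReal (4 ^ (s / 2) * 4 ^ (-(s / 2) * |((j + ⌊Real.logb 4 t⌋ : ℤ) : ℝ)|) *
            2 ^ ((j : ℝ) * -s)) * lrNorm r (dyadicBlock φ j f)) := by
          gcongr
      _ = _ := by
          rw [ENNReal.ofReal_mul (by positivity), ENNReal.ofReal_mul (by positivity), besovTerm]
          ring
  have hsum : ∀ t : ℝ, 0 < t → ENNReal.ofReal (t ^ (s / 2)) * lrNorm r (heat t f) ≤
      D * ∑' j, w (j + ⌊Real.logb 4 t⌋) * besovTerm φ (-s) r f j := by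
    intro t ht
    have hlim := ((heat (n := n) (F := F) t).continuous.tendsto f).comp
      (tendsto_sum_dyadicBlock φ hf.1.1)
    simp only [Function.comp_def, map_sum] at hlim
    have hfin : Tendsto (fun J : ℕ => Finset.Ico (-J : ℤ) J) atTop atTop := by
      refine tendsto_atTop_finset_of_monotone (fun J K h => ?_) fun j => ?_
      · exact Finset.Ico_subset_Ico (by simpa using h) (by simpa using h)
      · refine ⟨j.natAbs + 1, ?_⟩
        simp only [Finset.mem_Ico]
        omega
    calc _ ≤ ENNReal.ofReal (t ^ (s / 2)) * ∑' j, lrNorm r (heat t (dyadicBlock φ j f)) := by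
          gcongr
          exact lrNorm_le_tsum hfin hlim
      _ = ∑' j, ENNReal.ofReal (t ^ (s / 2)) * lrNorm r (heat t (dyadicBlock φ j f)) :=
          ENNReal.tsum_mul_left.symm
      _ ≤ ∑' j, D * (w (j + ⌊Real.logb 4 t⌋) * besovTerm φ (-s) r f j) :=
          ENNReal.tsum_le_tsum (hblock t ht)
      _ = _ := ENNReal.tsum_mul_left
  have hk : Tendsto (fun t : ℝ => ⌊Real.logb 4 t⌋) atTop atTop :=
    tendsto_floor_atTop.comp (Real.tendsto_logb_atTop (by norm_num))
  have hlim := ENNReal.Tendsto.const_mul ((tendsto_tsum_mul_shift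
    (tsum_ofReal_rpow_abs_ne_top (half_pos hs)) hf.1.2 hf.2).comp hk) (.inr hDt)
  rw [mul_zero] at hlim
  refine tendsto_of_tendsto_of_tendsto_of_le_of_le' tendsto_const_nhds hlim
    (.of_forall fun _ => zero_le) ?_
  filter_upwards [eventually_gt_atTop 0] with t ht
  exact hsum t ht

theorem tendsto_besovTerm_of_heat {n : ℕ} {F : Type*} [NormedAddCommGroup F] [NormedSpace ℂ F]
    [CompleteSpace F] (φ : DyadicPartition n) {r : ℝ≥0∞} [Fact (1 ≤ r)]
    {s : ℝ} {f : 𝓢'(EuclideanSpace ℝ (Fin n), F)}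
    (hf : Tendsto (fun t : ℝ => ENNReal.ofReal (t ^ (s / 2)) * lrNorm r (heat t f)) atTop (𝓝 0)) :
    Tendsto (besovTerm φ (-s) r f) atBot (𝓝 0) := by
  obtain ⟨C, hC, h⟩ := exists_lrNorm_dyadicBlock_le φ F r
  have ht : Tendsto (fun j : ℤ => (4 : ℝ) ^ (-j)) atBot atTop :=
    ((tendsto_rpow_atTop_of_base_gt_one 4 (by norm_num)).comp
      (tendsto_intCast_atTop_atTop.comp tendsto_neg_atBot_atTop)).congr fun j =>
        Real.rpow_intCast 4 (-j)
  have hlim := ENNReal.Tendsto.const_mul (hf.comp ht) (.inr hC)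
  rw [mul_zero] at hlim
  refine tendsto_of_tendsto_of_tendsto_of_le_of_le tendsto_const_nhds hlim
    (fun _ => zero_le) fun j => ?_
  have e : ((4 : ℝ) ^ (-j)) ^ (s / 2) = 2 ^ ((j : ℝ) * -s) := by
    rw [← Real.rpow_intCast, ← Real.rpow_mul (by norm_num), show (4 : ℝ) = 2 ^ (2 : ℝ) by norm_num,
      ← Real.rpow_mul two_pos.le]
    congr 1
    push_cast
    ring
  simp only [besovTerm, Function.comp_apply, e]
  calc _ ≤ ENNReal.ofReal (2 ^ ((j : ℝ) * -s)) * (C * lrNorm r (heat ((4 : ℝ) ^ (-j)) f)) := by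
        gcongr
        exact h j f
    _ = _ := by ring

end Equivalence

end HeatBesov

theorem mainTheorem6 {n : ℕ} {F : Type*} [NormedAddCommGroup F] [NormedSpace ℂ F]
    [CompleteSpace F] (φ : HeatBesov.DyadicPartition n) (r : ℝ≥0∞) [Fact (1 ≤ r)]
    (s : ℝ) (hs : 0 < s) (f : 𝓢'(EuclideanSpace ℝ (Fin n), F))
    (hf : f ∈ HeatBesov.besov φ F (-s) r) :
    f ∈ HeatBesov.besovC0 φ F (-s) r ↔
      Tendsto (fun t : ℝ => ENNReal.ofReal (t ^ (s / 2)) * HeatBesov.lrNorm r (HeatBesov.heat t f))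
        atTop (𝓝 0) :=
  ⟨fun h => HeatBesov.tendsto_heat_of_besovC0 hs h,
    fun h => ⟨hf, HeatBesov.tendsto_besovTerm_of_heat φ h⟩⟩
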